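/- **Theorem 3 (High-dimensional MSE).** Let $p\ge 1$, let $\mathcal G=(V,E)$ be an undirected graph without loops on $V=\{1,\dots,p\}$, with $E$ regarded as a symmetric set of ordered pairs, and put $\widetilde E=E\cup\{(i,i):i\in V\}$. Let $J^*\in\mathbb R^{p\times p}$ be symmetric positive definite with $J^*_{ij}=0$ for all $(i,j)\notin\widetilde E$, let $\Sigma^*=(J^*)^{-1}$, $\bar\sigma=\max_i\Sigma^*_{ii}$, and let $\bar\kappa$ be a real number with $\lambda_{\max}(J^*)\le\bar\kappa$. Let $x(1),\dots,x(T)$ be i.i.d. samples from $N(0,\Sigma^*)$ and $\widehat\Sigma=\frac1T\sum_{t=1}^T x(t)x(t)^{\mathsf T}$. For each node $i$ let $\mathcal N_i\subseteq V$ be any set containing $i$ and all its neighbors. Let $\mathcal B_i$ be the set of $j\in\mathcal N_i$ that have a neighbor outside $\mathcal N_i$, let $\mathcal P_i=\mathcal N_i\setminus\mathcal B_i$, and define the relaxed edge set (of ordered pairs) $$R_i=\Big(\widetilde E\cap\big((\mathcal P_i\times\mathcal P_i)\cup(\mathcal P_i\times\mathcal B_i)\cup(\mathcal B_i\times\mathcal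 P_i)\big)\Big)\cup(\mathcal B_i\times\mathcal B_i).$$ Put $\bar R=\max_i|R_i|$ and $r=\sum_{i=1}^p|R_i|$. Let $\widehat K^{i}$ be a solution of $$\min_{K}\ \langle\widehat\Sigma_{\mathcal N_i,\mathcal N_i},K\rangle-\log\det K\quad\text{subject to } K\succeq0,\ K_{jk}=0\ \text{ for all }(j,k)\in(\mathcal N_i\times\mathcal N_i)\setminus R_i$$ (with $-\log\det K=+\infty$ for singular $K$). The estimator $\widehat J^{\mathrm{Relax}}$ has entries $\widehat J^{\mathrm{Relax}}_{ij}=\widehat K^{i}_{ij}$ for $(i,j)\in\widetilde E$ and $\widehat J^{\mathrm{Relax}}_{ij}=0$ otherwise. Let $C\ge1$ and assume $$T\ \ge\ C^2c_1\log p,\qquad c_1=\frac{6400\,\bar\sigma^2}{\min\big\{\frac{1}{9\bar\kappa\sqrt{\bar R}},\,40\bar\sigma\big\}^2}.$$ Then, with probability greater than $1-4/p^{2(C^2-1)}$, all the local problems have solutions, and (for every choice of solutions) $$\|\widehat J^{\mathrm{Relax}}-J^*\|_F\ \le\ 720\,C\,\bar\kappa^2\,\bar\sigma\,\sqrt{\frac{r\log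 p}{T}}.$$ -/

import Mathlib

noncomputable section

namespace RMML

open scoped Classical

variable {V : Type*} [Fintype V]

/-- The index set `Ẽ = E ∪ {(i,i)}` of ordered pairs. -/
def extEdges (G : SimpleGraph V) : Finset (V × V) :=
  Finset.univ.filter fun e => G.Adj e.1 e.2 ∨ e.1 = e.2

/-- A choice, for every node `i`, of a neighborhood `𝒩 i` containing at least `i` and all of its
immediate neighbors. -/
structure Neighborhoods (G : SimpleGraph V) where
  set : V → Finset V
  self_mem : ∀ i, i ∈ set i
  adj_mem : ∀ i j, G.Adj i j → j ∈ set i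

/-- The buffer set: nodes of `N` with an immediate neighbor outside `N`. -/
def buffer (G : SimpleGraph V) (N : Finset V) : Finset V :=
  N.filter fun j => ∃ k, G.Adj j k ∧ k ∉ N

/-- The protected set `N \ B`. -/
def protectedSet (G : SimpleGraph V) (N : Finset V) : Finset V :=
  N \ buffer G N

/-- The protected local edges `Ẽ ∩ (P × P ∪ P × B ∪ B × P)`. -/
def protEdges (G : SimpleGraph V) (N : Finset V) : Finset (V × V) :=
  extEdges G ∩
    (protectedSet G N ×ˢ protectedSet G N ∪ protectedSet G N ×ˢ buffer G N ∪
      buffer G N ×ˢ protectedSet G N)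

/-- The relaxed edge set `R = E^Prot ∪ B × B`, a set of ordered pairs. -/
def relaxedEdges (G : SimpleGraph V) (N : Finset V) : Finset (V × V) :=
  protEdges G N ∪ buffer G N ×ˢ buffer G N

/-- `⟨S, K⟩ - log det K`, with the convention `- log det K = +∞` at singular `K ⪰ 0`. -/
def logdetObjective {W : Type*} [Fintype W] (S K : Matrix W W ℝ) : EReal :=
  if 0 < K.det then (((S * K).trace - Real.log K.det : ℝ) : EReal) else ⊤

/-- Feasible matrices of the local relaxed problem on `N`: positive semidefinite, and supported
on the relaxed edge set. -/
def relaxedFeasible (G : SimpleGraph V) (N : Finset V) : Set (Matrix N N ℝ) :=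
  {K | K.PosSemidef ∧ ∀ j k : N, ((j : V), (k : V)) ∉ relaxedEdges G N → K j k = 0}

/-- `K` solves the local relaxed problem on `N` with (global) sample covariance `S`. -/
def IsLocalSolution (G : SimpleGraph V) (N : Finset V) (S : Matrix V V ℝ)
    (K : Matrix N N ℝ) : Prop :=
  K ∈ relaxedFeasible G N ∧
    IsMinOn (logdetObjective (S.submatrix (fun j : N => (j : V)) (fun j : N => (j : V))))
      (relaxedFeasible G N) K

/-- Concatenation of row parameters: the entries of row `i` indexed by `Ẽ` are those of the
`i`-th local matrix; the entries outside `Ẽ` are zero. -/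
def concatenate (G : SimpleGraph V) (𝒩 : Neighborhoods G)
    (K : ∀ i, Matrix (𝒩.set i) (𝒩.set i) ℝ) : Matrix V V ℝ :=
  fun i j =>
    if h : G.Adj i j ∨ i = j then
      K i ⟨i, 𝒩.self_mem i⟩
        ⟨j, h.elim (𝒩.adj_mem i j) fun e => e ▸ 𝒩.self_mem i⟩
    else 0

/-- `J` is a relaxed maximum marginal likelihood estimate from the sample covariance `S`. -/
def IsRelaxEstimate (G : SimpleGraph V) (𝒩 : Neighborhoods G) (S J : Matrix V V ℝ) : Prop :=
  ∃ K : ∀ i, Matrix (𝒩.set i) (𝒩.set i) ℝ,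
    (∀ i, IsLocalSolution G (𝒩.set i) S (K i)) ∧ J = concatenate G 𝒩 K

/-- The sample covariance matrix `(1/T) ∑ₜ x(t) x(t)ᵀ` of `T` centered observations. -/
def sampleCov {T : ℕ} (x : Fin T → EuclideanSpace ℝ V) : Matrix V V ℝ :=
  (1 / (T : ℝ)) • ∑ t, Matrix.vecMulVec (x t).ofLp (x t).ofLp

/-- Largest eigenvalue of a symmetric matrix. -/
def lambdaMax [Nonempty V] {A : Matrix V V ℝ} (hA : A.IsHermitian) : ℝ :=
  Finset.univ.sup' Finset.univ_nonempty hA.eigenvalues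

/-- Largest diagonal entry: the maximum variance, for a covariance matrix. -/
def maxVar [Nonempty V] (S : Matrix V V ℝ) : ℝ :=
  Finset.univ.sup' Finset.univ_nonempty fun i => S i i

/-- `R̄`, the maximal cardinality of the relaxed edge sets. -/
def maxRelaxed (G : SimpleGraph V) (𝒩 : Neighborhoods G) : ℕ :=
  Finset.univ.sup fun i => (relaxedEdges G (𝒩.set i)).card

/-- `r`, the sum of the cardinalities of the relaxed edge sets. -/
def sumRelaxed (G : SimpleGraph V) (𝒩 : Neighborhoods G) : ℕ :=
  ∑ i, (relaxedEdges G (𝒩.set i)).card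

/-- The constant `c₁ = 6400 σ² / min {1 / (9 κ √R), 40 σ} ²`. -/
def sampleConst (σ κ : ℝ) (R : ℕ) : ℝ :=
  6400 * σ ^ 2 / (min (1 / (9 * κ * √(R : ℝ))) (40 * σ)) ^ 2

open scoped Matrix.Norms.Frobenius in
/-- The Frobenius norm. -/
def frobeniusNorm (A : Matrix V V ℝ) : ℝ := ‖A‖

end RMML

end

/-! ### The log-determinant divergence. -/

section

open Matrix

/-! Marginalizing onto `𝒩 i` gives the concentration matrix `K₀ = (Σ*_{𝒩,𝒩})⁻¹`. It agrees with `J*`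
in rows and columns of protected nodes (`inv_submatrix_apply_of_protected`), and all fill-in lies in
buffer × buffer. So `K₀` is feasible for the relaxed problem, and row `i`, a protected one, carries
the true entries.

If `K` does at least as well as `K₀`, the divergence of `K` from `K₀` is at most `|tr((Σ̂ - Σ*)(K -
K₀))|`, hence at most `δ √|R| ‖K - K₀‖` when the covariance entries err by at most `δ`. Whitening by
`K₀^{1/2}` bounds the divergence below by `N²/(2(1+N))` with `‖K - K₀‖ ≤ κN`. Together these give
`‖K - K₀‖ ≤ 9κ²√|R| δ` (`sqrt_sum_sq_sub_le_of_logdet_le`). The bound covers the whole sublevel set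
of `K₀`, so compactness also yields solutions. Adding the squared row errors produces `r`.

The randomness enters only through `δ`: polarization reduces each entry of the sample covariance to
empirical variances of Gaussian scalars, Chernoff's bound controls these, and a union bound over
`p²` entries finishes. -/

theorem Matrix.IsHermitian.exists_orthogonal_diagonal {W : Type*} [Fintype W] [DecidableEq W]
    {M : Matrix W W ℝ} (hM : M.IsHermitian) :
    ∃ U : Matrix W W ℝ, U * Uᵀ = 1 ∧ Uᵀ * U = 1 ∧ M = U * diagonal hM.eigenvalues * Uᵀ := by
  refine ⟨hM.eigenvectorUnitary, ?_, ?_, ?_⟩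
  · simpa [star_eq_conjTranspose] using Unitary.coe_mul_star_self hM.eigenvectorUnitary
  · simpa [star_eq_conjTranspose] using Unitary.coe_star_mul_self hM.eigenvectorUnitary
  · have := hM.spectral_theorem
    simpa [Unitary.conjStarAlgAut_apply, star_eq_conjTranspose, Function.comp_def] using this

theorem Matrix.trace_transpose_mul_self_eq_sum {m n : Type*} [Fintype m] [Fintype n]
    (A : Matrix m n ℝ) : (Aᵀ * A).trace = ∑ i, ∑ j, A i j ^ 2 := by
  rw [Finset.sum_comm]
  simp [trace, mul_apply, sq]

/-- Applied to each eigenvalue; `m` is separate from `|x|` so that one denominator serves them all.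
The difference `g` of the two sides vanishes at 0 and is monotone: increasing for `x ≥ 0`, and for
`x ≤ 0` decreasing even with `x²/2` in place of the quotient. -/
theorem Real.sq_div_le_sub_log_one_add {x m : ℝ} (hx : -1 < x) (hm : |x| ≤ m) :
    x ^ 2 / (2 * (1 + m)) ≤ x - log (1 + x) := by
  have hm0 : 0 ≤ m := (abs_nonneg x).trans hm
  have hmono : x ^ 2 / (2 * (1 + m)) ≤ x ^ 2 / (2 * (1 + |x|)) := by gcongr
  refine hmono.trans ?_
  rcases le_total 0 x with h | h
  · rw [abs_of_nonneg h]
    let g : ℝ → ℝ := fun y => y - log (1 + y) - y ^ 2 / (2 * (1 + y))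
    have hd : ∀ y : ℝ, 0 < 1 + y →
        HasDerivAt g (1 - 1 / (1 + y) -
          (2 * y * (2 * (1 + y)) - y ^ 2 * 2) / (2 * (1 + y)) ^ 2) y := by
      intro y hy
      have h1 : HasDerivAt (fun y : ℝ => 1 + y) 1 y := (hasDerivAt_id y).const_add 1
      have h2 : HasDerivAt (fun y : ℝ => y ^ 2) (2 * y) y := by
        simpa using hasDerivAt_pow 2 y
      have h3 : HasDerivAt (fun y : ℝ => 2 * (1 + y)) 2 y := by simpa using h1.const_mul 2
      exact ((hasDerivAt_id y).sub (h1.log hy.ne')).sub (h2.div h3 (by positivity))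
    have hg : MonotoneOn g (Set.Ici 0) := by
      apply monotoneOn_of_deriv_nonneg (convex_Ici 0)
      · intro y hy
        exact (hd y (by have : (0 : ℝ) ≤ y := hy; linarith)).continuousAt.continuousWithinAt
      · intro y hy
        rw [interior_Ici] at hy
        exact (hd y (by have : (0 : ℝ) < y := hy; linarith)).differentiableAt
          |>.differentiableWithinAt
      · intro y hy
        rw [interior_Ici] at hy
        have hy' : (0 : ℝ) < y := hy
        rw [(hd y (by linarith)).deriv]
        have : 1 - 1 / (1 + y) - (2 * y * (2 * (1 + y)) - y ^ 2 * 2) / (2 * (1 + y)) ^ 2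
            = y ^ 2 / (2 * (1 + y) ^ 2) := by field_simp; ring
        rw [this]; positivity
    have := hg (Set.mem_Ici.2 le_rfl) (Set.mem_Ici.2 h) h
    simp only [g] at this
    norm_num at this
    linarith
  · have h1 : log (1 + x) ≤ x - x ^ 2 / 2 := by
      let g : ℝ → ℝ := fun y => y - log (1 + y) - y ^ 2 / 2
      have hd : ∀ y : ℝ, 0 < 1 + y → HasDerivAt g (1 - 1 / (1 + y) - y) y := by
        intro y hy
        have h1 : HasDerivAt (fun y : ℝ => 1 + y) 1 y := (hasDerivAt_id y).const_add 1
        have h2 : HasDerivAt (fun y : ℝ => y ^ 2 / 2) y y := by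
          exact ((hasDerivAt_pow 2 y).div_const 2).congr_deriv (by norm_num)
        exact ((hasDerivAt_id y).sub (h1.log hy.ne')).sub h2
      have hg : AntitoneOn g (Set.Ioc (-1) 0) := by
        apply antitoneOn_of_deriv_nonpos (convex_Ioc _ _)
        · intro y hy
          exact (hd y (by linarith [hy.1])).continuousAt.continuousWithinAt
        · intro y hy
          rw [interior_Ioc] at hy
          exact (hd y (by linarith [hy.1])).differentiableAt.differentiableWithinAt
        · intro y hy
          rw [interior_Ioc] at hy
          have h0 : 0 < 1 + y := by linarith [hy.1]
          rw [(hd y h0).deriv]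
          have : 1 - 1 / (1 + y) - y = - (y ^ 2 / (1 + y)) := by field_simp; ring
          rw [this, neg_nonpos]; positivity
      have := hg (show x ∈ Set.Ioc (-1 : ℝ) 0 from ⟨hx, h⟩) (show (0 : ℝ) ∈ Set.Ioc (-1 : ℝ) 0 by simp) h
      simp only [g] at this
      norm_num at this
      linarith
    have h2 : x ^ 2 / (2 * (1 + |x|)) ≤ x ^ 2 / 2 := by
      gcongr
      linarith [abs_nonneg x]
    linarith

/-- Lower bound for the log-determinant Bregman divergence at the identity. -/
theorem Matrix.IsHermitian.sq_div_le_trace_sub_log_det {W : Type*} [Fintype W] [DecidableEq W]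
    {M : Matrix W W ℝ} (hM : M.IsHermitian) (hpos : (1 + M).PosDef) {N : ℝ} (hN : 0 ≤ N)
    (hMN : ∑ i, ∑ j, M i j ^ 2 = N ^ 2) :
    N ^ 2 / (2 * (1 + N)) ≤ M.trace - Real.log (1 + M).det := by
  obtain ⟨U, h1, h2, h⟩ := hM.exists_orthogonal_diagonal
  generalize hM.eigenvalues = d at h
  subst h
  have hadd : 1 + U * diagonal d * Uᵀ = U * diagonal (fun i => 1 + d i) * Uᵀ := by
    rw [show diagonal (fun i => 1 + d i) = 1 + diagonal d by
      rw [← diagonal_one, diagonal_add], mul_add, add_mul, mul_one, h1]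
  have htr : (U * diagonal d * Uᵀ).trace = ∑ i, d i := by
    rw [trace_mul_comm, ← mul_assoc, h2, one_mul, trace_diagonal]
  have hsq : N ^ 2 = ∑ i, d i ^ 2 := by
    rw [← hMN, ← trace_transpose_mul_self_eq_sum]
    have : (U * diagonal d * Uᵀ)ᵀ * (U * diagonal d * Uᵀ)
        = U * (diagonal d * diagonal d) * Uᵀ := by
      simp only [transpose_mul, transpose_transpose, diagonal_transpose]
      calc U * (diagonal d * Uᵀ) * (U * diagonal d * Uᵀ)
          = U * diagonal d * (Uᵀ * U) * diagonal d * Uᵀ := by simp only [mul_assoc]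
        _ = _ := by rw [h2]; simp only [mul_assoc, mul_one]
    rw [this, trace_mul_comm, ← mul_assoc, h2, one_mul, diagonal_mul_diagonal, trace_diagonal]
    simp [sq]
  have hdet : (1 + U * diagonal d * Uᵀ).det = ∏ i, (1 + d i) := by
    rw [hadd, det_mul, mul_comm, ← det_mul, ← mul_assoc, h2, one_mul, det_diagonal]
  have hd : ∀ i, -1 < d i := by
    have hU : IsUnit U := IsUnit.of_mul_eq_one _ h1
    rw [hadd] at hpos
    have := (hU.posDef_star_right_conjugate_iff (x := diagonal fun i => 1 + d i)).1
      (by simpa [star_eq_conjTranspose] using hpos)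
    rw [posDef_diagonal_iff] at this
    intro i
    linarith [this i]
  have hdN : ∀ i, |d i| ≤ N := by
    intro i
    refine abs_le_of_sq_le_sq ?_ hN
    rw [hsq]
    exact Finset.single_le_sum (f := fun i => d i ^ 2) (fun _ _ => sq_nonneg _) (Finset.mem_univ i)
  rw [hdet, htr, Real.log_prod (fun i _ => by linarith [hd i]), ← Finset.sum_sub_distrib, hsq,
    Finset.sum_div]
  exact Finset.sum_le_sum fun i _ => Real.sq_div_le_sub_log_one_add (hd i) (hdN i)

/-- Here `κ` bounds the squared operator norm of `S`; the Frobenius bound follows column by column.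
-/
theorem Matrix.sum_sq_mul_le {m n : Type*} [Fintype m] [Fintype n]
    {S : Matrix n n ℝ} {κ : ℝ} (hS : ∀ x : n → ℝ, (S *ᵥ x) ⬝ᵥ (S *ᵥ x) ≤ κ * (x ⬝ᵥ x))
    (A : Matrix n m ℝ) :
    ∑ i, ∑ j, (S * A) i j ^ 2 ≤ κ * ∑ i, ∑ j, A i j ^ 2 := by
  rw [Finset.sum_comm, Finset.sum_comm (f := fun i j => A i j ^ 2), Finset.mul_sum]
  refine Finset.sum_le_sum fun j _ => ?_
  have := hS (fun i => A i j)
  simpa [dotProduct, mulVec, mul_apply, sq] using this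

theorem Matrix.sum_sq_transpose {m n : Type*} [Fintype m] [Fintype n] (A : Matrix m n ℝ) :
    ∑ i, ∑ j, Aᵀ i j ^ 2 = ∑ i, ∑ j, A i j ^ 2 := by
  rw [Finset.sum_comm]; rfl

open scoped MatrixOrder in
theorem Matrix.PosDef.exists_symm_sqrt {W : Type*} [Fintype W] [DecidableEq W]
    {K : Matrix W W ℝ} (hK : K.PosDef) :
    ∃ S : Matrix W W ℝ, Sᵀ = S ∧ S * S = K ∧ IsUnit S.det := by
  have h0 : 0 ≤ K := hK.posSemidef.nonneg
  have hs : CFC.sqrt K * CFC.sqrt K = K := CFC.sqrt_mul_sqrt_self K h0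
  refine ⟨CFC.sqrt K, ?_, hs, ?_⟩
  · simpa using (CFC.sqrt_nonneg K).posSemidef.isHermitian.eq
  · have : IsUnit ((CFC.sqrt K).det * (CFC.sqrt K).det) := by
      rw [← det_mul, hs]; exact hK.det_pos.ne'.isUnit
    exact isUnit_of_mul_isUnit_left this

/-- Decomposition of the log-determinant divergence at a positive definite matrix `K₀`: the
Frobenius distance from `K₀` is controlled by `N`, and `N` by the divergence. -/
theorem Matrix.PosDef.exists_divergence_bound {W : Type*} [Fintype W] [DecidableEq W]
    {K₀ K S₀ : Matrix W W ℝ} (hK₀ : K₀.PosDef) (hK : K.PosDef) (hS₀ : S₀ * K₀ = 1)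
    {κ : ℝ} (hκ : 0 ≤ κ) (hK₀κ : ∀ x, x ⬝ᵥ K₀ *ᵥ x ≤ κ * (x ⬝ᵥ x)) :
    ∃ N : ℝ, 0 ≤ N ∧ ∑ i, ∑ j, (K - K₀) i j ^ 2 ≤ (κ * N) ^ 2 ∧
      N ^ 2 / (2 * (1 + N)) ≤
        (S₀ * (K - K₀)).trace - (Real.log K.det - Real.log K₀.det) := by
  obtain ⟨S, hST, hSS, hSu⟩ := hK₀.exists_symm_sqrt
  have hS1 : S * S⁻¹ = 1 := mul_nonsing_inv _ hSu
  have hS2 : S⁻¹ * S = 1 := nonsing_inv_mul _ hSu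
  have hSiT : (S⁻¹)ᵀ = S⁻¹ := by rw [transpose_nonsing_inv, hST]
  -- Whitening by the square root `S` of `K₀`: since `K = S(1 + M)S`, the divergence becomes `tr M -
  -- log det(1 + M)`, and `N` is the Frobenius norm of `M`.
  set M := S⁻¹ * (K - K₀) * S⁻¹ with hMdef
  have hΔ : K - K₀ = S * M * S := by
    calc K - K₀ = (S * S⁻¹) * (K - K₀) * (S⁻¹ * S) := by rw [hS1, hS2, one_mul, mul_one]
      _ = _ := by simp only [hMdef, mul_assoc]
  have hMT : Mᵀ = M := by
    have h1 : Kᵀ = K := by simpa using hK.isHermitian.eq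
    have h2 : K₀ᵀ = K₀ := by simpa using hK₀.isHermitian.eq
    simp only [hMdef, transpose_mul, transpose_sub, h1, h2, hSiT, mul_assoc]
  have h1M : 1 + M = S⁻¹ * K * S⁻¹ := by
    have : S⁻¹ * K₀ * S⁻¹ = 1 := by
      rw [← hSS]
      calc S⁻¹ * (S * S) * S⁻¹ = (S⁻¹ * S) * (S * S⁻¹) := by simp only [mul_assoc]
        _ = 1 := by rw [hS1, hS2, one_mul]
    rw [hMdef, mul_sub, sub_mul, this]; abel
  have hKS : K = S * (1 + M) * S := by
    rw [h1M]
    calc K = (S * S⁻¹) * K * (S⁻¹ * S) := by rw [hS1, hS2, one_mul, mul_one]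
      _ = _ := by simp only [mul_assoc]
  have hpos : (1 + M).PosDef := by
    have hu : IsUnit S⁻¹ := IsUnit.of_mul_eq_one _ hS2
    rw [h1M]
    have := (hu.posDef_star_right_conjugate_iff (x := K)).2 hK
    simpa only [star_eq_conjTranspose, conjTranspose_eq_transpose_of_trivial, hSiT] using this
  have hS₀' : S₀ = S⁻¹ * S⁻¹ := by
    have : (S⁻¹ * S⁻¹) * K₀ = 1 := by
      rw [← hSS]
      calc S⁻¹ * S⁻¹ * (S * S) = S⁻¹ * (S⁻¹ * S) * S := by simp only [mul_assoc]
        _ = 1 := by rw [hS2, mul_one, hS2]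
    have h3 : K₀ * S₀ = 1 := mul_eq_one_comm.1 hS₀
    calc S₀ = (S⁻¹ * S⁻¹ * K₀) * S₀ := by rw [this, one_mul]
      _ = _ := by rw [mul_assoc, h3, mul_one]
  have htr : (S₀ * (K - K₀)).trace = M.trace := by
    rw [hS₀', hΔ]
    calc (S⁻¹ * S⁻¹ * (S * M * S)).trace = (S⁻¹ * ((S⁻¹ * S) * M * S)).trace := by
          simp only [mul_assoc]
      _ = M.trace := by rw [hS2, one_mul, trace_mul_comm, mul_assoc, hS1, mul_one]
  have hdet : Real.log K.det - Real.log K₀.det = Real.log (1 + M).det := by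
    have : K.det = K₀.det * (1 + M).det := by
      conv_lhs => rw [hKS]
      rw [← hSS]; simp only [det_mul]; ring
    rw [this, Real.log_mul hK₀.det_pos.ne' hpos.det_pos.ne']; ring
  have hSκ : ∀ x, (S *ᵥ x) ⬝ᵥ (S *ᵥ x) ≤ κ * (x ⬝ᵥ x) := by
    intro x
    have : (S *ᵥ x) ⬝ᵥ (S *ᵥ x) = x ⬝ᵥ K₀ *ᵥ x := by
      rw [dotProduct_mulVec, ← mulVec_transpose, hST, mulVec_mulVec, hSS, dotProduct_comm]
    rw [this]; exact hK₀κ x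
  have hsum0 : 0 ≤ ∑ i, ∑ j, M i j ^ 2 := by positivity
  refine ⟨√(∑ i, ∑ j, M i j ^ 2), Real.sqrt_nonneg _, ?_, ?_⟩
  · rw [mul_pow, Real.sq_sqrt hsum0, hΔ, mul_assoc S M S, sq κ, mul_assoc κ κ]
    refine (sum_sq_mul_le hSκ _).trans ?_
    gcongr
    -- Transposing turns the right factor `S` into a left one; each factor costs one `κ`.
    rw [← sum_sq_transpose, transpose_mul, hST, hMT]
    exact sum_sq_mul_le hSκ _
  · rw [htr, hdet]
    exact IsHermitian.sq_div_le_trace_sub_log_det (by simpa [IsHermitian] using hMT) hpos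
      (Real.sqrt_nonneg _) (Real.sq_sqrt hsum0).symm

/-- Sparsity enters here: the trace is at most `δ` times the ℓ¹ norm of `Δ`, and Cauchy–Schwarz on
the support `R` costs only `√|R|`. -/
theorem Matrix.abs_trace_mul_le {W : Type*} [Fintype W] {D Δ : Matrix W W ℝ} {δ : ℝ}
    (hδ : 0 ≤ δ) (hD : ∀ i j, |D i j| ≤ δ) {R : Finset (W × W)}
    (hΔ : ∀ i j, (i, j) ∉ R → Δ i j = 0) :
    |(D * Δ).trace| ≤ δ * √(R.card) * √(∑ i, ∑ j, Δ i j ^ 2) := by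
  have h1 : (D * Δ).trace = ∑ e ∈ R, D e.2 e.1 * Δ e.1 e.2 := by
    rw [trace_mul_comm]
    simp only [trace, diag, mul_apply]
    rw [← Finset.sum_product', Finset.univ_product_univ]
    symm
    rw [← Finset.sum_subset (Finset.subset_univ R)]
    · exact Finset.sum_congr rfl fun _ _ => mul_comm _ _
    · intro e _ he
      rw [hΔ e.1 e.2 he, zero_mul]
  have h2 : ∑ e ∈ R, Δ e.1 e.2 ^ 2 ≤ ∑ i, ∑ j, Δ i j ^ 2 := by
    rw [← Finset.sum_product', Finset.univ_product_univ]
    exact Finset.sum_le_sum_of_subset_of_nonneg (Finset.subset_univ R) fun _ _ _ => sq_nonneg _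
  have h3 : ∑ e ∈ R, |Δ e.1 e.2| ≤ √(R.card) * √(∑ i, ∑ j, Δ i j ^ 2) := by
    rw [← Real.sqrt_mul (by positivity)]
    apply Real.le_sqrt_of_sq_le
    refine sq_sum_le_card_mul_sum_sq.trans ?_
    simp only [sq_abs]
    gcongr
  rw [h1, mul_assoc]
  calc |∑ e ∈ R, D e.2 e.1 * Δ e.1 e.2| ≤ ∑ e ∈ R, δ * |Δ e.1 e.2| := by
        refine (Finset.abs_sum_le_sum_abs _ _).trans (Finset.sum_le_sum fun e _ => ?_)
        rw [abs_mul]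
        gcongr
        exact hD _ _
    _ = δ * ∑ e ∈ R, |Δ e.1 e.2| := by rw [Finset.mul_sum]
    _ ≤ _ := by gcongr

theorem Matrix.PosDef.sqrt_sum_sq_sub_le_of_logdet_le {W : Type*} [Fintype W] [DecidableEq W]
    {K₀ K S₀ S : Matrix W W ℝ} (hK₀ : K₀.PosDef) (hK : K.PosDef) (hS₀ : S₀ * K₀ = 1)
    {κ : ℝ} (hκ : 0 ≤ κ) (hK₀κ : ∀ x, x ⬝ᵥ K₀ *ᵥ x ≤ κ * (x ⬝ᵥ x))
    {δ : ℝ} (hδ : 0 ≤ δ) (hS : ∀ i j, |(S - S₀) i j| ≤ δ) {R : Finset (W × W)}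
    (hR₀ : ∀ i j, (i, j) ∉ R → K₀ i j = 0) (hR : ∀ i j, (i, j) ∉ R → K i j = 0)
    (hsmall : κ * √(R.card) * δ ≤ 1 / 9)
    (hle : (S * K).trace - Real.log K.det ≤ (S * K₀).trace - Real.log K₀.det) :
    √(∑ i, ∑ j, (K - K₀) i j ^ 2) ≤ 9 * κ ^ 2 * √(R.card) * δ := by
  obtain ⟨N, hN, hΔN, hdiv⟩ := hK₀.exists_divergence_bound hK hS₀ hκ hK₀κ
  have h1 := abs_trace_mul_le (Δ := K - K₀) hδ hS (R := R)
    (fun i j h => by rw [sub_apply, hR i j h, hR₀ i j h, sub_zero])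
  have h2 : √(∑ i, ∑ j, (K - K₀) i j ^ 2) ≤ κ * N := Real.sqrt_le_iff.2 ⟨by positivity, hΔN⟩
  have h3 : (S₀ * (K - K₀)).trace - (Real.log K.det - Real.log K₀.det)
      ≤ - ((S - S₀) * (K - K₀)).trace := by
    have : ((S - S₀) * (K - K₀)).trace =
        (S * K).trace - (S * K₀).trace - (S₀ * (K - K₀)).trace := by
      rw [sub_mul, trace_sub, mul_sub, trace_sub]
    linarith
  set ε := κ * √(R.card) * δ with hε
  have hε0 : 0 ≤ ε := by positivity
  have h4 : N ^ 2 / (2 * (1 + N)) ≤ ε * N := by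
    calc _ ≤ _ := hdiv.trans (h3.trans ((neg_le_abs _).trans h1))
      _ ≤ δ * √(R.card) * (κ * N) := by gcongr
      _ = ε * N := by rw [hε]; ring
  -- Cancelling `N` leaves `N ≤ 2ε(1 + N)`, and `ε ≤ 1/9` gives `N ≤ (18/7)ε`. The final constant 9
  -- is looser still.
  have h5 : N ≤ 3 * ε := by
    rcases hN.eq_or_lt with h | h
    · rw [← h]; positivity
    · rw [div_le_iff₀ (by positivity)] at h4
      have : N * N ≤ (ε * (2 * (1 + N))) * N := by nlinarith
      have := le_of_mul_le_mul_right this h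
      nlinarith
  calc _ ≤ κ * N := h2
    _ ≤ κ * (9 * ε) := by gcongr; linarith
    _ = _ := by rw [hε]; ring

end

/-! ### Existence of minimizers and marginal concentration matrices. -/

section

open Matrix

theorem Matrix.isCompact_entrywise_closedBall {W : Type*} [Fintype W] (K₀ : Matrix W W ℝ) (ρ : ℝ) :
    IsCompact {K : Matrix W W ℝ | ∀ i j, K i j ∈ Set.Icc (K₀ i j - ρ) (K₀ i j + ρ)} := by
  have hset : {K : Matrix W W ℝ | ∀ i j, K i j ∈ Set.Icc (K₀ i j - ρ) (K₀ i j + ρ)} =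
      (Set.univ.pi fun i => Set.univ.pi fun j => Set.Icc (K₀ i j - ρ) (K₀ i j + ρ) :
        Set (W → W → ℝ)) := by
    refine Set.ext fun K => ?_
    exact ⟨fun h i _ j _ => h i j, fun h i j => h i trivial j trivial⟩
  rw [hset]
  exact isCompact_univ_pi fun i => isCompact_univ_pi fun j => isCompact_Icc

theorem Matrix.isClosed_setOf_posSemidef {W : Type*} [Fintype W] :
    IsClosed {K : Matrix W W ℝ | K.PosSemidef} := by
  have : {K : Matrix W W ℝ | K.PosSemidef} =
      {K | Kᴴ = K} ∩ ⋂ x : W → ℝ, {K | 0 ≤ star x ⬝ᵥ K *ᵥ x} := by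
    ext K
    simp [posSemidef_iff_dotProduct_mulVec, IsHermitian]
  rw [this]
  refine IsClosed.inter (isClosed_eq (by fun_prop) (by fun_prop)) (isClosed_iInter fun x => ?_)
  exact isClosed_le (by fun_prop) (by fun_prop)

namespace RMML

variable {V : Type*} [Fintype V]

theorem logdetObjective_of_pos {W : Type*} [Fintype W] [DecidableEq W] (S : Matrix W W ℝ)
    {K : Matrix W W ℝ} (hK : 0 < K.det) :
    logdetObjective S K = (((S * K).trace - Real.log K.det : ℝ) : EReal) := by
  unfold logdetObjective
  split_ifs with h
  · congr!
  · exact absurd (by convert hK) h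

theorem posDef_of_logdetObjective_le {W : Type*} [Fintype W] [DecidableEq W] {S : Matrix W W ℝ}
    {K K₀ : Matrix W W ℝ} (hK : K.PosSemidef) (hK₀ : 0 < K₀.det)
    (h : logdetObjective S K ≤ logdetObjective S K₀) : K.PosDef := by
  have hdet : 0 < K.det := by
    by_contra hneg
    rw [logdetObjective_of_pos S hK₀, logdetObjective, if_neg (by convert hneg)] at h
    exact absurd (top_le_iff.1 h) (EReal.coe_ne_top _)
  exact hK.posDef_iff_isUnit.2 ((isUnit_iff_isUnit_det K).2 hdet.ne'.isUnit)

/-- If all sublevel points at a positive definite feasible point lie in a bounded set, the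
log-determinant problem on a closed set of positive semidefinite matrices has a solution. -/
theorem exists_isMinOn_logdetObjective {W : Type*} [Fintype W] [DecidableEq W]
    {S K₀ : Matrix W W ℝ} {F : Set (Matrix W W ℝ)} (hF : IsClosed F) (hK₀F : K₀ ∈ F)
    (hK₀ : 0 < K₀.det) {ρ : ℝ}
    (hρ : ∀ K ∈ F, logdetObjective S K ≤ logdetObjective S K₀ → ∀ i j, |(K - K₀) i j| ≤ ρ) :
    ∃ K ∈ F, IsMinOn (logdetObjective S) F K := by
  have hcomp : IsCompact
      ({K : Matrix W W ℝ | ∀ i j, K i j ∈ Set.Icc (K₀ i j - ρ) (K₀ i j + ρ)} ∩ F) :=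
    (isCompact_entrywise_closedBall K₀ ρ).inter_right hF
  have hball : ∀ K ∈ F, logdetObjective S K ≤ logdetObjective S K₀ →
      ∀ i j, K i j ∈ Set.Icc (K₀ i j - ρ) (K₀ i j + ρ) := by
    intro K hK hle i j
    have := abs_le.1 (hρ K hK hle i j)
    rw [Matrix.sub_apply] at this
    constructor <;> linarith [this.1, this.2]
  -- The exponential of minus the objective is maximized instead: it is continuous on all matrices
  -- and vanishes at singular ones.
  obtain ⟨K, ⟨-, hKF⟩, hmax⟩ := hcomp.exists_isMaxOn ⟨K₀, hball K₀ hK₀F le_rfl, hK₀F⟩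
    (f := fun K : Matrix W W ℝ => K.det * Real.exp (-(S * K).trace))
    (by fun_prop)
  have hmax₀ := hmax ⟨hball K₀ hK₀F le_rfl, hK₀F⟩
  simp only [Set.mem_ofPred_eq] at hmax₀
  have hKdet : 0 < K.det := by
    have : 0 < K.det * Real.exp (-(S * K).trace) := lt_of_lt_of_le (by positivity) hmax₀
    exact pos_of_mul_pos_left this (Real.exp_pos _).le
  have key : ∀ L : Matrix W W ℝ, 0 < L.det →
      L.det * Real.exp (-(S * L).trace) ≤ K.det * Real.exp (-(S * K).trace) →
      logdetObjective S K ≤ logdetObjective S L := by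
    intro L hL hle
    rw [logdetObjective_of_pos S hKdet, logdetObjective_of_pos S hL, EReal.coe_le_coe_iff]
    have := Real.log_le_log (by positivity) hle
    rw [Real.log_mul hL.ne' (Real.exp_ne_zero _), Real.log_mul hKdet.ne' (Real.exp_ne_zero _),
      Real.log_exp, Real.log_exp] at this
    linarith
  refine ⟨K, hKF, fun L hL => ?_⟩
  rw [Set.mem_ofPred_eq]
  rcases le_or_gt (logdetObjective S L) (logdetObjective S K₀) with h | h
  · by_cases hLdet : 0 < L.det
    · exact key L hLdet (hmax ⟨hball L hL h, hL⟩)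
    · rw [logdetObjective_of_pos S hK₀, logdetObjective, if_neg (by convert hLdet)] at h
      exact absurd (top_le_iff.1 h) (EReal.coe_ne_top _)
  · exact (key K₀ hK₀ hmax₀).trans h.le

theorem isClosed_relaxedFeasible (G : SimpleGraph V) (N : Finset V) :
    IsClosed (relaxedFeasible G N) := by
  have : relaxedFeasible G N = {K | K.PosSemidef} ∩ ⋂ (j : N) (k : N),
      {K | ((j : V), (k : V)) ∉ relaxedEdges G N → K j k = 0} := by
    ext K
    simp [relaxedFeasible]
  rw [this]
  refine isClosed_setOf_posSemidef.inter (isClosed_iInter fun j => isClosed_iInter fun k => ?_)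
  by_cases h : ((j : V), (k : V)) ∈ relaxedEdges G N
  · simp [h]
  · simp only [h, not_false_eq_true, forall_const]
    exact isClosed_eq (by fun_prop) (by fun_prop)

theorem mem_extEdges {G : SimpleGraph V} {i j : V} :
    (i, j) ∈ extEdges G ↔ G.Adj i j ∨ i = j := by
  simp [extEdges]

theorem mem_protectedSet {G : SimpleGraph V} {N : Finset V} {j : V} :
    j ∈ protectedSet G N ↔ j ∈ N ∧ ∀ k, G.Adj j k → k ∈ N := by
  simp only [protectedSet, buffer, Finset.mem_sdiff, Finset.mem_filter]
  grind

theorem self_mem_protectedSet {G : SimpleGraph V} (𝒩 : Neighborhoods G) (i : V) :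
    i ∈ protectedSet G (𝒩.set i) :=
  mem_protectedSet.2 ⟨𝒩.self_mem i, 𝒩.adj_mem i⟩

theorem mem_relaxedEdges_self {G : SimpleGraph V} (𝒩 : Neighborhoods G) (i : V) :
    (i, i) ∈ relaxedEdges G (𝒩.set i) := by
  simp [relaxedEdges, protEdges, mem_extEdges, self_mem_protectedSet]

/-- A pair of nodes of `N` outside the relaxed edge set has a protected end and is not an edge. -/
theorem of_notMem_relaxedEdges {G : SimpleGraph V} {N : Finset V} {j k : V} (hj : j ∈ N)
    (hk : k ∈ N) (h : (j, k) ∉ relaxedEdges G N) :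
    (j ∈ protectedSet G N ∨ k ∈ protectedSet G N) ∧ j ≠ k ∧ ¬ G.Adj j k := by
  have hmem : ∀ l ∈ N, l ∈ protectedSet G N ∨ l ∈ buffer G N := by
    intro l hl
    by_cases hb : l ∈ buffer G N
    · exact Or.inr hb
    · exact Or.inl (by simp [protectedSet, hl, hb])
  simp only [relaxedEdges, protEdges, Finset.mem_union, Finset.mem_inter, Finset.mem_product,
    mem_extEdges] at h
  have := hmem j hj
  have := hmem k hk
  tauto

/-- The columns of the marginal concentration matrix at protected nodes are those of the full
concentration matrix. -/
theorem inv_submatrix_apply_of_protected [DecidableEq V] {G : SimpleGraph V} {N : Finset V}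
    {J : Matrix V V ℝ} (hJ : J.PosDef) (hMarkov : ∀ i j, i ≠ j → ¬ G.Adj i j → J i j = 0)
    {K : Matrix N N ℝ}
    (hK : K * (J⁻¹.submatrix (fun j : N => (j : V)) (fun j : N => (j : V))) = 1)
    (j k : N) (hk : (k : V) ∈ protectedSet G N) : K j k = J j k := by
  set S := J⁻¹.submatrix (fun j : N => (j : V)) (fun j : N => (j : V)) with hS
  have hJ1 : J⁻¹ * J = 1 := nonsing_inv_mul _ hJ.det_pos.ne'.isUnit
  have hsymm : ∀ i j, J i j = J j i := fun i j => by
    simpa using congrFun (congrFun hJ.isHermitian.eq j) i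
  -- Column `k` of `J` vanishes outside `N` because `k` is protected, so the identity `J⁻¹ J = 1`
  -- restricts to `N` with no leftover terms.
  have hcol : S *ᵥ (fun l : N => J l k) = Pi.single k 1 := by
    ext m
    have h1 : ∑ l : V, J⁻¹ m l * J l k = (1 : Matrix V V ℝ) m k := by
      rw [← mul_apply, hJ1]
    have h2 : ∑ l : N, J⁻¹ m l * J l k = ∑ l : V, J⁻¹ m l * J l k := by
      rw [Finset.sum_coe_sort N (fun l => J⁻¹ m l * J l k)]
      refine Finset.sum_subset (Finset.subset_univ N) fun l _ hl => ?_
      have hlk : J l k = 0 := by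
        rw [hsymm]
        refine hMarkov _ _ (fun h => hl (h ▸ k.2)) fun hadj => hl ?_
        exact (mem_protectedSet.1 hk).2 l hadj
      rw [hlk, mul_zero]
    have h3 : (S *ᵥ fun l : N => J l k) m = ∑ l : N, J⁻¹ m l * J l k := rfl
    rw [h3, h2, h1, one_apply, Pi.single_apply]
    simp only [Subtype.ext_iff]
  have : K *ᵥ (S *ᵥ fun l : N => J l k) = fun l : N => J l k := by
    rw [mulVec_mulVec, hK, one_mulVec]
  rw [hcol] at this
  simpa using congrFun this j

end RMML

/-- Expand the `J`-form at `κ J⁻¹y - y`, which is nonnegative. Lower bounds on the inverse pass to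
principal submatrices, and the next lemma inverts back; thus `K₀` inherits the bound `κ`. -/
theorem Matrix.PosDef.dotProduct_self_le_inv {n : Type*} [Fintype n] [DecidableEq n]
    {J : Matrix n n ℝ} (hJ : J.PosDef) {κ : ℝ} (hκ : 0 < κ)
    (h : ∀ x, x ⬝ᵥ J *ᵥ x ≤ κ * (x ⬝ᵥ x)) (y : n → ℝ) :
    y ⬝ᵥ y ≤ κ * (y ⬝ᵥ J⁻¹ *ᵥ y) := by
  set z := J⁻¹ *ᵥ y with hz
  have hJz : J *ᵥ z = y := by
    rw [hz, mulVec_mulVec, mul_nonsing_inv _ hJ.det_pos.ne'.isUnit, one_mulVec]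
  have hT : Jᵀ = J := by simpa using hJ.isHermitian.eq
  have h1 : 0 ≤ (κ • z - y) ⬝ᵥ J *ᵥ (κ • z - y) := by
    simpa using hJ.posSemidef.dotProduct_mulVec_nonneg (κ • z - y)
  have h2 : z ⬝ᵥ J *ᵥ y = y ⬝ᵥ y := by
    rw [dotProduct_mulVec, ← mulVec_transpose, hT, hJz]
  rw [mulVec_sub, mulVec_smul, hJz, sub_dotProduct, dotProduct_sub, dotProduct_sub,
    smul_dotProduct, smul_dotProduct, dotProduct_smul, dotProduct_smul, h2,
    dotProduct_comm z y] at h1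
  simp only [smul_eq_mul] at h1
  have h3 := h y
  have : 0 ≤ κ * (κ * (y ⬝ᵥ z) - y ⬝ᵥ y) := by nlinarith
  have := nonneg_of_mul_nonneg_right this hκ
  linarith

theorem Matrix.dotProduct_mulVec_le_of_inv {n : Type*} [Fintype n] [DecidableEq n]
    {K S : Matrix n n ℝ} {κ : ℝ} (hκ : 0 < κ) (hSK : S * K = 1)
    (h : ∀ y, y ⬝ᵥ y ≤ κ * (y ⬝ᵥ S *ᵥ y)) (x : n → ℝ) :
    x ⬝ᵥ K *ᵥ x ≤ κ * (x ⬝ᵥ x) := by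
  set y := K *ᵥ x with hy
  have hSy : S *ᵥ y = x := by rw [hy, mulVec_mulVec, hSK, one_mulVec]
  have h1 := h y
  rw [hSy] at h1
  have h2 : 0 ≤ (κ • x - y) ⬝ᵥ (κ • x - y) := by
    simpa using dotProduct_self_star_nonneg (κ • x - y)
  rw [sub_dotProduct, dotProduct_sub, dotProduct_sub,
    smul_dotProduct, smul_dotProduct, dotProduct_smul, dotProduct_smul,
    dotProduct_comm y x] at h2
  simp only [smul_eq_mul] at h2
  rw [dotProduct_comm y x] at h1
  have : 0 ≤ κ * (κ * (x ⬝ᵥ x) - x ⬝ᵥ y) := by nlinarith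
  have := nonneg_of_mul_nonneg_right this hκ
  linarith

end

/-! ### Chernoff bounds for squares of Gaussian variables. -/

section

open MeasureTheory ProbabilityTheory

/-- The left side is the cumulant generating function of `x² - 1` for a standard Gaussian `x`; use
`log w ≥ 1 - 1/w`. -/
theorem Real.neg_half_log_one_sub_le {u : ℝ} (h : |u| ≤ 1 / 4) :
    -(1 / 2) * log (1 - 2 * u) - u ≤ 4 * u ^ 2 := by
  obtain ⟨h1, h2⟩ := abs_le.1 h
  have hpos : 0 < 1 - 2 * u := by linarith
  have hle : 1 - (1 - 2 * u)⁻¹ ≤ log (1 - 2 * u) := one_sub_inv_le_log_of_pos hpos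
  have hinv : (1 - 2 * u)⁻¹ ≤ 1 + 2 * u + 8 * u ^ 2 := by
    rw [inv_le_iff_one_le_mul₀ hpos]
    nlinarith [sq_nonneg u, mul_nonneg (sq_nonneg u) (by linarith : 0 ≤ 1 / 4 - u)]
  nlinarith

namespace ProbabilityTheory

theorem integral_exp_mul_sq_gaussianReal_zero_one {u : ℝ} (hu : u < 1 / 2) :
    ∫ x, Real.exp (u * x ^ 2) ∂(gaussianReal 0 1) = (√(1 - 2 * u))⁻¹ := by
  rw [integral_gaussianReal_eq_integral_smul one_ne_zero]
  have h : ∀ x : ℝ, gaussianPDFReal 0 1 x • Real.exp (u * x ^ 2) =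
      (√(2 * Real.pi))⁻¹ * Real.exp (-((1 - 2 * u) / 2) * x ^ 2) := by
    intro x
    rw [gaussianPDFReal_def, smul_eq_mul, mul_assoc, ← Real.exp_add]
    simp only [NNReal.coe_one, mul_one, sub_zero]
    congr 2
    ring
  have hpos : 0 < 1 - 2 * u := by linarith
  simp_rw [h]
  rw [integral_const_mul, integral_gaussian, ← Real.sqrt_inv, ← Real.sqrt_inv,
    ← Real.sqrt_mul (by positivity)]
  congr 1
  field_simp

theorem integral_exp_mul_sq_gaussianReal_zero {v : NNReal} {l : ℝ} (hl : l * v < 1 / 2) :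
    ∫ x, Real.exp (l * x ^ 2) ∂(gaussianReal 0 v) = (√(1 - 2 * (l * v)))⁻¹ := by
  have hmap : gaussianReal 0 v = (gaussianReal 0 1).map (√(v : ℝ) * ·) := by
    rw [gaussianReal_map_const_mul, mul_zero, mul_one]
    congr 1
    ext
    simp
  rw [hmap, integral_map (by fun_prop) (by fun_prop),
    ← integral_exp_mul_sq_gaussianReal_zero_one hl]
  refine integral_congr_ae (Filter.Eventually.of_forall fun x => ?_)
  simp only [mul_pow, Real.sq_sqrt v.coe_nonneg, mul_assoc]

/-- The centered square of a Gaussian variable has a sub-Gaussian moment generating function near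
the origin. -/
theorem mgf_sq_sub_var_gaussianReal_le {v : NNReal} {l : ℝ} (hl : |l * v| ≤ 1 / 4) :
    Integrable (fun x => Real.exp (l * (x ^ 2 - v))) (gaussianReal 0 v) ∧
    mgf (fun x => x ^ 2 - (v : ℝ)) (gaussianReal 0 v) l ≤ Real.exp (4 * (l * v) ^ 2) := by
  have hlt : l * v < 1 / 2 := by linarith [le_of_abs_le hl]
  have hpos : 0 < 1 - 2 * (l * v) := by linarith
  have hmgf : mgf (fun x => x ^ 2 - (v : ℝ)) (gaussianReal 0 v) l =
      Real.exp (-(1 / 2) * Real.log (1 - 2 * (l * v)) - l * v) := by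
    have : ∀ x : ℝ, Real.exp (l * (x ^ 2 - v)) = Real.exp (l * x ^ 2) * Real.exp (-(l * v)) := by
      intro x; rw [← Real.exp_add]; ring_nf
    simp only [mgf, this]
    rw [integral_mul_const, integral_exp_mul_sq_gaussianReal_zero hlt, sub_eq_add_neg _ (l * _),
      Real.exp_add]
    congr 1
    rw [neg_mul, Real.exp_neg, Real.sqrt_eq_rpow, Real.rpow_def_of_pos hpos, mul_comm (1 / 2 : ℝ)]
  refine ⟨?_, ?_⟩
  -- A non-integrable function has integral 0 by convention, so the positive value just computed
  -- forces integrability.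
  · refine Integrable.of_integral_ne_zero ?_
    have := hmgf
    rw [mgf] at this
    rw [this]
    positivity
  · rw [hmgf, Real.exp_le_exp]
    exact Real.neg_half_log_one_sub_le hl

variable {Ω : Type*} [MeasurableSpace Ω] {P : Measure Ω}

theorem mgf_sum_sq_sub_var_le [IsProbabilityMeasure P] {T : ℕ} {Y : Fin T → Ω → ℝ}
    {v : NNReal} (hY : ∀ t, HasLaw (Y t) (gaussianReal 0 v) P) (hindep : iIndepFun Y P)
    {l : ℝ} (hl : |l * v| ≤ 1 / 4) :
    Integrable (fun ω => Real.exp (l * ∑ t, (Y t ω ^ 2 - (v : ℝ)))) P ∧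
    mgf (fun ω => ∑ t, (Y t ω ^ 2 - (v : ℝ))) P l ≤ Real.exp (T * (4 * (l * v) ^ 2)) := by
  have hind : iIndepFun (fun t ω => Y t ω ^ 2 - (v : ℝ)) P :=
    hindep.comp (fun _ x => x ^ 2 - (v : ℝ)) (fun _ => by fun_prop)
  have hmeas : ∀ t, AEMeasurable (fun ω => Y t ω ^ 2 - (v : ℝ)) P := fun t =>
    ((hY t).aemeasurable.pow_const 2).sub_const _
  obtain ⟨hint, hle⟩ := mgf_sq_sub_var_gaussianReal_le hl
  have hint' : ∀ t, Integrable (fun ω => Real.exp (l * (Y t ω ^ 2 - (v : ℝ)))) P := by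
    intro t
    rw [← (hY t).map_eq] at hint
    exact hint.comp_aemeasurable (hY t).aemeasurable
  have hmgf : ∀ t, mgf (fun ω => Y t ω ^ 2 - (v : ℝ)) P l ≤ Real.exp (4 * (l * v) ^ 2) := by
    intro t
    refine le_of_eq_of_le ?_ hle
    rw [mgf, mgf, ← (hY t).map_eq, integral_map (hY t).aemeasurable (by fun_prop)]
  have hsum : (fun ω => ∑ t, (Y t ω ^ 2 - (v : ℝ))) = ∑ t, fun ω => Y t ω ^ 2 - (v : ℝ) := by
    ext ω; simp
  constructor
  · refine Integrable.of_integral_ne_zero ?_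
    have hprod : mgf (fun ω => ∑ t, (Y t ω ^ 2 - (v : ℝ))) P l =
        ∏ t, mgf (fun ω => Y t ω ^ 2 - (v : ℝ)) P l := by rw [hsum, hind.mgf_sum₀ hmeas]
    rw [mgf] at hprod
    rw [hprod]
    exact (Finset.prod_pos fun t _ => mgf_pos (hint' t)).ne'
  · rw [hsum, hind.mgf_sum₀ hmeas]
    refine (Finset.prod_le_prod (fun t _ => mgf_nonneg) fun t _ => hmgf t).trans ?_
    rw [Finset.prod_const, Finset.card_univ, Fintype.card_fin, ← Real.exp_nat_mul]

/-- Two-sided Chernoff bound for the empirical variance of centered Gaussian variables. -/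
theorem measureReal_abs_sum_sq_sub_var_ge_le [IsProbabilityMeasure P] {T : ℕ}
    {Y : Fin T → Ω → ℝ} {v : NNReal} (hY : ∀ t, HasLaw (Y t) (gaussianReal 0 v) P)
    (hindep : iIndepFun Y P) {b s : ℝ} (hb : 0 < b) (hvb : (v : ℝ) ≤ b) (hs : 0 ≤ s)
    (hsb : s ≤ b) :
    P.real {ω | T * s ≤ |∑ t, (Y t ω ^ 2 - (v : ℝ))|} ≤
      2 * Real.exp (-(T * s ^ 2 / (16 * b ^ 2))) := by
  -- The minimizer of the Chernoff exponent `-lTs + 4T(lb)²`; `s ≤ b` keeps it where the moment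
  -- bound is valid.
  set l := s / (8 * b ^ 2) with hl
  have hl0 : 0 ≤ l := by positivity
  have hlb : l * b ≤ 1 / 4 := by
    rw [hl, div_mul_eq_mul_div, div_le_div_iff₀ (by positivity) (by norm_num)]
    nlinarith
  have hlv : |l * v| ≤ 1 / 4 := by
    rw [abs_of_nonneg (by positivity)]
    exact (mul_le_mul_of_nonneg_left hvb hl0).trans hlb
  have hlv' : |(-l) * v| ≤ 1 / 4 := by rwa [neg_mul, abs_neg]
  have hexp : ∀ m : ℝ, m ^ 2 = l ^ 2 →
      Real.exp (-l * (T * s)) * Real.exp (T * (4 * (m * v) ^ 2)) ≤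
        Real.exp (-(T * s ^ 2 / (16 * b ^ 2))) := by
    intro m hm
    rw [← Real.exp_add, Real.exp_le_exp]
    have h1 : (m * v) ^ 2 ≤ (l * b) ^ 2 := by
      rw [mul_pow, hm, mul_pow]; gcongr
    have h2 : -l * (T * s) + T * (4 * (l * b) ^ 2) = -(T * s ^ 2 / (16 * b ^ 2)) := by
      rw [hl]; field_simp; ring
    have h3 : (T : ℝ) * (4 * (m * v) ^ 2) ≤ T * (4 * (l * b) ^ 2) := by gcongr
    linarith
  obtain ⟨hi1, hm1⟩ := mgf_sum_sq_sub_var_le hY hindep hlv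
  obtain ⟨hi2, hm2⟩ := mgf_sum_sq_sub_var_le hY hindep hlv'
  have hup := (measure_ge_le_exp_mul_mgf (T * s : ℝ) hl0 hi1).trans
    ((mul_le_mul_of_nonneg_left hm1 (Real.exp_pos _).le).trans (hexp l rfl))
  have hlo := (measure_le_le_exp_mul_mgf (-(T * s) : ℝ) (neg_nonpos.2 hl0) hi2).trans
    ((mul_le_mul_of_nonneg_left hm2 (Real.exp_pos _).le).trans
      (by simpa using hexp (-l) (by ring)))
  have hsub : {ω | T * s ≤ |∑ t, (Y t ω ^ 2 - (v : ℝ))|} ⊆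
      {ω | T * s ≤ ∑ t, (Y t ω ^ 2 - (v : ℝ))} ∪
        {ω | ∑ t, (Y t ω ^ 2 - (v : ℝ)) ≤ -(T * s)} := by
    intro ω hω
    rcases le_abs.1 (Set.mem_ofPred_eq ▸ hω) with h | h
    · exact Or.inl h
    · exact Or.inr (by rw [Set.mem_ofPred_eq]; linarith)
  calc _ ≤ _ := measureReal_mono hsub
    _ ≤ _ := measureReal_union_le _ _
    _ ≤ _ := by linarith

open Matrix in
theorem hasLaw_inner_multivariateGaussian {ι : Type*} [Fintype ι] [DecidableEq ι]
    {S : Matrix ι ι ℝ} (hS : S.PosSemidef) {X : Ω → EuclideanSpace ℝ ι}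
    (hX : HasLaw X (multivariateGaussian 0 S) P) (a : EuclideanSpace ℝ ι) :
    HasLaw (fun ω => inner ℝ a (X ω)) (gaussianReal 0 (a ⬝ᵥ S *ᵥ a).toNNReal) P := by
  have hL : HasLaw (innerSL ℝ a) (gaussianReal 0 (a ⬝ᵥ S *ᵥ a).toNNReal)
      (multivariateGaussian 0 S) := by
    refine ⟨by fun_prop, ?_⟩
    rw [IsGaussian.map_eq_gaussianReal]
    congr 1
    · rw [(innerSL ℝ a).integral_comp_id_comm IsGaussian.integrable_id]
      simp
    · rw [← covarianceBilin_multivariateGaussian (μ := 0) hS,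
        covarianceBilin_self IsGaussian.memLp_two_id]
      rfl
  exact hL.fun_comp hX

end ProbabilityTheory

end

/-! ### Deterministic error bounds, local and global. -/

section

open Matrix

namespace RMML

variable {V : Type*} [Fintype V]

theorem dotProduct_mulVec_le_lambdaMax [Nonempty V] [DecidableEq V] {A : Matrix V V ℝ}
    (hA : A.IsHermitian) (x : V → ℝ) : x ⬝ᵥ A *ᵥ x ≤ lambdaMax hA * (x ⬝ᵥ x) := by
  obtain ⟨U, h1, h2, h⟩ := hA.exists_orthogonal_diagonal
  have hle : ∀ i, hA.eigenvalues i ≤ lambdaMax hA := fun i => by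
    refine (Finset.le_sup' hA.eigenvalues (Finset.mem_univ i)).trans (le_of_eq ?_)
    unfold lambdaMax
    congr!
  set y := Uᵀ *ᵥ x with hy
  have hxy : x ⬝ᵥ x = y ⬝ᵥ y := by
    rw [hy, dotProduct_mulVec, vecMul_transpose, mulVec_mulVec, h1, one_mulVec]
  have hquad : x ⬝ᵥ A *ᵥ x = y ⬝ᵥ diagonal hA.eigenvalues *ᵥ y := by
    conv_lhs => rw [h]
    rw [hy, ← mulVec_mulVec, ← mulVec_mulVec, dotProduct_mulVec x U, mulVec_transpose]
  rw [hquad, hxy]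
  simp only [dotProduct, mulVec_diagonal, Finset.mul_sum]
  refine Finset.sum_le_sum fun i _ => ?_
  nlinarith [mul_le_mul_of_nonneg_right (hle i) (mul_self_nonneg (y i))]

theorem lambdaMax_pos [Nonempty V] [DecidableEq V] {A : Matrix V V ℝ} (hA : A.PosDef) :
    0 < lambdaMax hA.isHermitian := by
  obtain ⟨i⟩ := ‹Nonempty V›
  have h := dotProduct_mulVec_le_lambdaMax hA.isHermitian (Pi.single i 1)
  have h2 : 0 < A i i := hA.diag_pos
  simp only [mulVec_single_one, single_one_dotProduct] at h
  simp only [col_apply, Pi.single_eq_same, mul_one] at h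
  linarith

/-- Deterministic analysis of one local problem. -/
theorem local_problem [DecidableEq V] {G : SimpleGraph V} {J S : Matrix V V ℝ} (hJ : J.PosDef)
    (hMarkov : ∀ i j, i ≠ j → ¬ G.Adj i j → J i j = 0) {κ : ℝ} (hκ : 0 < κ)
    (hJκ : ∀ x, x ⬝ᵥ J *ᵥ x ≤ κ * (x ⬝ᵥ x)) {δ : ℝ} (hδ : 0 ≤ δ)
    (hS : ∀ i j, |(S - J⁻¹) i j| ≤ δ) (N : Finset V)
    (hsmall : κ * √((relaxedEdges G N).card) * δ ≤ 1 / 9) :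
    ∃ K₀ : Matrix N N ℝ, (∀ j k : N, (j : V) ∈ protectedSet G N → K₀ j k = J j k) ∧
      (∃ K, IsLocalSolution G N S K) ∧
      ∀ K, IsLocalSolution G N S K →
        √(∑ j, ∑ k, (K - K₀) j k ^ 2) ≤ 9 * κ ^ 2 * √((relaxedEdges G N).card) * δ := by
  set f : N → V := fun j => (j : V) with hf
  have hfinj : Function.Injective f := Subtype.val_injective
  set S₀ : Matrix N N ℝ := J⁻¹.submatrix f f with hS₀
  have hS₀pd : S₀.PosDef := hJ.inv.submatrix hfinj
  set K₀ := S₀⁻¹ with hK₀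
  have hK₀pd : K₀.PosDef := hS₀pd.inv
  have hSK : S₀ * K₀ = 1 := mul_nonsing_inv _ hS₀pd.det_pos.ne'.isUnit
  have hKS : K₀ * S₀ = 1 := nonsing_inv_mul _ hS₀pd.det_pos.ne'.isUnit
  have hJsymm : ∀ i j, J i j = J j i := fun i j => by
    simpa using congrFun (congrFun hJ.isHermitian.eq j) i
  have hKsymm : ∀ i j, K₀ i j = K₀ j i := fun i j => by
    simpa using congrFun (congrFun hK₀pd.isHermitian.eq j) i
  have hcol : ∀ j k : N, (k : V) ∈ protectedSet G N → K₀ j k = J j k := fun j k hk =>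
    inv_submatrix_apply_of_protected hJ hMarkov hKS j k hk
  have hrow : ∀ j k : N, (j : V) ∈ protectedSet G N → K₀ j k = J j k := fun j k hj => by
    rw [hKsymm, hcol k j hj, hJsymm]
  -- Feasibility of `K₀`: a forbidden pair has a protected end, where `K₀` equals `J`, and is not an
  -- edge.
  have hsupp : ∀ j k : N, ((j : V), (k : V)) ∉ relaxedEdges G N → K₀ j k = 0 := by
    intro j k h
    obtain ⟨hp, hne, hadj⟩ := of_notMem_relaxedEdges j.2 k.2 h
    rcases hp with hp | hp
    · rw [hrow j k hp]; exact hMarkov _ _ hne hadj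
    · rw [hcol j k hp]; exact hMarkov _ _ hne hadj
  have hK₀κ : ∀ x, x ⬝ᵥ K₀ *ᵥ x ≤ κ * (x ⬝ᵥ x) := by
    refine dotProduct_mulVec_le_of_inv hκ hSK fun y => ?_
    -- Extension by zero turns the form of `S₀` into that of `J⁻¹`.
    set z : V → ℝ := fun i => if h : i ∈ N then y ⟨i, h⟩ else 0 with hz
    have hzN : ∀ j : N, z j = y j := fun j => by simp [hz]
    have hsum : ∀ g : V → ℝ, ∑ i, z i * g i = ∑ j : N, y j * g j := by
      intro g
      have h1 : ∑ j : N, y j * g j = ∑ j : N, z j * g j :=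
        Finset.sum_congr rfl fun j _ => by rw [hzN]
      rw [h1, Finset.sum_coe_sort N (fun i => z i * g i)]
      refine (Finset.sum_subset (Finset.subset_univ N) fun i _ hi => ?_).symm
      simp [hz, hi]
    have h := hJ.dotProduct_self_le_inv hκ hJκ z
    have e1 : z ⬝ᵥ z = y ⬝ᵥ y := by
      rw [dotProduct, hsum]
      exact Finset.sum_congr rfl fun j _ => by rw [hzN]
    have e2 : z ⬝ᵥ J⁻¹ *ᵥ z = y ⬝ᵥ S₀ *ᵥ y := by
      rw [dotProduct, hsum]
      refine Finset.sum_congr rfl fun j _ => ?_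
      congr 1
      have : (J⁻¹ *ᵥ z) j = ∑ i, z i * J⁻¹ j i := by
        simp only [mulVec, dotProduct, mul_comm]
      rw [this, hsum]
      simp [mulVec, dotProduct, hS₀, hf, mul_comm]
    rwa [e1, e2] at h
  set R : Finset (N × N) := Finset.univ.filter fun e => ((e.1 : V), (e.2 : V)) ∈ relaxedEdges G N
    with hR
  have hRcard : R.card ≤ (relaxedEdges G N).card := by
    refine Finset.card_le_card_of_injOn (fun e => ((e.1 : V), (e.2 : V)))
      (fun e he => by simpa [hR] using he) ?_
    rintro ⟨a, b⟩ - ⟨c, d⟩ - h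
    exact Prod.ext (Subtype.ext (Prod.ext_iff.1 h).1) (Subtype.ext (Prod.ext_iff.1 h).2)
  have hmemR : ∀ (K : Matrix N N ℝ),
      (∀ j k : N, ((j : V), (k : V)) ∉ relaxedEdges G N → K j k = 0) →
      ∀ j k, (j, k) ∉ R → K j k = 0 := fun K hK j k h => hK j k (by simpa [hR] using h)
  have hsqrt : √(R.card : ℝ) ≤ √((relaxedEdges G N).card) :=
    Real.sqrt_le_sqrt (by exact_mod_cast hRcard)
  have hsmall' : κ * √(R.card) * δ ≤ 1 / 9 := le_trans (by gcongr) hsmall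
  have hK₀F : K₀ ∈ relaxedFeasible G N := ⟨hK₀pd.posSemidef, hsupp⟩
  have hbound : ∀ K ∈ relaxedFeasible G N,
      logdetObjective (S.submatrix f f) K ≤ logdetObjective (S.submatrix f f) K₀ →
      √(∑ j, ∑ k, (K - K₀) j k ^ 2) ≤ 9 * κ ^ 2 * √((relaxedEdges G N).card) * δ := by
    intro K hK hle
    have hKpd := posDef_of_logdetObjective_le hK.1 hK₀pd.det_pos hle
    rw [logdetObjective_of_pos _ hKpd.det_pos, logdetObjective_of_pos _ hK₀pd.det_pos,
      EReal.coe_le_coe_iff] at hle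
    refine (hK₀pd.sqrt_sum_sq_sub_le_of_logdet_le hKpd hSK hκ.le hK₀κ hδ
      (fun i j => hS i j) (hmemR _ hsupp) (hmemR _ hK.2) hsmall' hle).trans ?_
    gcongr
  refine ⟨K₀, hrow, ?_, fun K hK => hbound K hK.1 (hK.2 hK₀F)⟩
  obtain ⟨K, hK, hmin⟩ := exists_isMinOn_logdetObjective (S := S.submatrix f f)
    (isClosed_relaxedFeasible G N) hK₀F hK₀pd.det_pos
    (ρ := 9 * κ ^ 2 * √((relaxedEdges G N).card) * δ) fun K hK hle i j => by
      refine le_trans ?_ (hbound K hK hle)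
      refine Real.abs_le_sqrt ?_
      refine (Finset.single_le_sum (f := fun j => (K - K₀) i j ^ 2) (fun _ _ => sq_nonneg _)
        (Finset.mem_univ j)).trans ?_
      exact Finset.single_le_sum (f := fun i => ∑ j, (K - K₀) i j ^ 2)
        (fun _ _ => Finset.sum_nonneg fun _ _ => sq_nonneg _) (Finset.mem_univ i)
  exact ⟨K, hK, hmin⟩

theorem frobeniusNorm_eq_sqrt (A : Matrix V V ℝ) :
    frobeniusNorm A = √(∑ i, ∑ j, A i j ^ 2) := by
  rw [frobeniusNorm, frobenius_norm_def, Real.sqrt_eq_rpow]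
  simp

/-- Deterministic error bound for the relaxed estimator, given an entrywise bound on the error of
the sample covariance. -/
theorem relaxEstimate_deterministic [DecidableEq V] {G : SimpleGraph V} (𝒩 : Neighborhoods G)
    {J S : Matrix V V ℝ} (hJ : J.PosDef)
    (hMarkov : ∀ i j, i ≠ j → ¬ G.Adj i j → J i j = 0) {κ : ℝ} (hκ : 0 < κ)
    (hJκ : ∀ x, x ⬝ᵥ J *ᵥ x ≤ κ * (x ⬝ᵥ x)) {δ : ℝ} (hδ : 0 ≤ δ)
    (hS : ∀ i j, |(S - J⁻¹) i j| ≤ δ)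
    (hsmall : ∀ i, κ * √((relaxedEdges G (𝒩.set i)).card) * δ ≤ 1 / 9) :
    (∃ J', IsRelaxEstimate G 𝒩 S J') ∧
      ∀ J', IsRelaxEstimate G 𝒩 S J' →
        frobeniusNorm (J' - J) ≤ 9 * κ ^ 2 * δ * √(sumRelaxed G 𝒩) := by
  choose K₀ hrow hex hbound using fun i =>
    local_problem (G := G) hJ hMarkov hκ hJκ hδ hS (𝒩.set i) (hsmall i)
  constructor
  · choose K hK using hex
    exact ⟨_, K, hK, rfl⟩
  rintro J' ⟨K, hK, rfl⟩
  have hrowbound : ∀ i, ∑ j, (concatenate G 𝒩 K - J) i j ^ 2 ≤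
      (9 * κ ^ 2 * δ) ^ 2 * (relaxedEdges G (𝒩.set i)).card := by
    intro i
    have hzero : ∀ j, ¬ (G.Adj i j ∨ i = j) → (concatenate G 𝒩 K - J) i j = 0 := by
      intro j hj
      rw [Matrix.sub_apply, concatenate, dif_neg hj, hMarkov i j (fun h => hj (Or.inr h))
        (fun h => hj (Or.inl h)), sub_zero]
    have h1 : ∑ j, (concatenate G 𝒩 K - J) i j ^ 2 =
        ∑ j : 𝒩.set i, (concatenate G 𝒩 K - J) i j ^ 2 := by
      rw [Finset.sum_coe_sort (𝒩.set i) (fun j => (concatenate G 𝒩 K - J) i j ^ 2)]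
      refine (Finset.sum_subset (Finset.subset_univ _) fun j _ hj => ?_).symm
      rw [hzero j, zero_pow two_ne_zero]
      rintro (h | rfl)
      · exact hj (𝒩.adj_mem i j h)
      · exact hj (𝒩.self_mem i)
    -- Node `i` is protected, so row `i` of `K₀ i` is that of `J`; setting entries outside `Ẽ` to
    -- zero only removes error. The whole local error then bounds this row.
    have h2 : ∑ j : 𝒩.set i, (concatenate G 𝒩 K - J) i j ^ 2 ≤
        ∑ j, (K i - K₀ i) ⟨i, 𝒩.self_mem i⟩ j ^ 2 := by
      refine Finset.sum_le_sum fun j _ => ?_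
      by_cases h : G.Adj i j ∨ i = j
      · rw [Matrix.sub_apply, Matrix.sub_apply, concatenate, dif_pos h,
          hrow i ⟨i, 𝒩.self_mem i⟩ j (self_mem_protectedSet 𝒩 i)]
      · rw [hzero _ h, zero_pow two_ne_zero]; positivity
    have h3 : ∑ j, (K i - K₀ i) ⟨i, 𝒩.self_mem i⟩ j ^ 2 ≤
        ∑ l, ∑ j, (K i - K₀ i) l j ^ 2 :=
      Finset.single_le_sum (f := fun l => ∑ j, (K i - K₀ i) l j ^ 2)
        (fun _ _ => Finset.sum_nonneg fun _ _ => sq_nonneg _) (Finset.mem_univ _)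
    have h4 := (Real.sqrt_le_iff.1 (hbound i (K i) (hK i))).2
    rw [h1]
    refine h2.trans (h3.trans (h4.trans (le_of_eq ?_)))
    rw [mul_pow, mul_pow, Real.sq_sqrt (Nat.cast_nonneg _)]
    ring
  rw [frobeniusNorm_eq_sqrt]
  refine Real.sqrt_le_iff.2 ⟨by positivity, ?_⟩
  rw [mul_pow, Real.sq_sqrt (Nat.cast_nonneg _), sumRelaxed, Nat.cast_sum, Finset.mul_sum]
  exact Finset.sum_le_sum fun i _ => hrowbound i

/-! ### Concentration of the sample covariance. -/

open MeasureTheory ProbabilityTheory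

/-- Entrywise concentration of the Gaussian sample covariance. -/
theorem measureReal_abs_sampleCov_sub_ge_le [DecidableEq V] {Ω : Type*} [MeasurableSpace Ω]
    {P : Measure Ω} [IsProbabilityMeasure P] {T : ℕ} (hT : 0 < T)
    {X : Fin T → Ω → EuclideanSpace ℝ V} {S : Matrix V V ℝ} (hS : S.PosSemidef)
    (hlaw : ∀ t, HasLaw (X t) (multivariateGaussian 0 S) P) (hindep : iIndepFun X P)
    {σ δ : ℝ} (hσ : 0 < σ) (hSσ : ∀ i, S i i ≤ σ) (hδ : 0 ≤ δ) (hδσ : δ ≤ 2 * σ) (j k : V) :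
    P.real {ω | δ < |(sampleCov (fun t => X t ω) - S) j k|} ≤
      4 * Real.exp (-(T * δ ^ 2 / (64 * σ ^ 2))) := by
  have hsymm : S k j = S j k := by simpa using congrFun (congrFun hS.isHermitian.eq j) k
  have hvar : ∀ c : ℝ, ∀ a : EuclideanSpace ℝ V,
      a = EuclideanSpace.single j 1 + c • EuclideanSpace.single k 1 →
      a ⬝ᵥ S *ᵥ a = S j j + c ^ 2 * S k k + 2 * c * S j k := by
    rintro c a rfl
    have : (EuclideanSpace.single j (1 : ℝ) + c • EuclideanSpace.single k (1 : ℝ)).ofLp =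
        Pi.single j 1 + c • Pi.single k 1 := by
      ext i; simp [Pi.single_apply]
    rw [this, mulVec_add, mulVec_smul, add_dotProduct, dotProduct_add, dotProduct_add,
      smul_dotProduct, smul_dotProduct, dotProduct_smul, dotProduct_smul]
    simp only [mulVec_single_one, single_one_dotProduct, col_apply, smul_eq_mul, hsymm]
    ring
  have hinner : ∀ c : ℝ, ∀ x : EuclideanSpace ℝ V,
      inner ℝ (EuclideanSpace.single j 1 + c • EuclideanSpace.single k 1) x = x j + c * x k := by
    intro c x
    rw [inner_add_left, real_inner_smul_left]
    simp [EuclideanSpace.inner_single_left]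
  have hv0 : ∀ c : ℝ, 0 ≤ S j j + c ^ 2 * S k k + 2 * c * S j k := by
    intro c
    rw [← hvar c _ rfl]
    simpa using hS.dotProduct_mulVec_nonneg
      (EuclideanSpace.single j (1 : ℝ) + c • EuclideanSpace.single k (1 : ℝ)).ofLp
  have htail : ∀ c : ℝ, c ^ 2 = 1 →
      P.real {ω | T * (2 * δ) ≤
        |∑ t, ((X t ω j + c * X t ω k) ^ 2 - (S j j + c ^ 2 * S k k + 2 * c * S j k))|} ≤
        2 * Real.exp (-(T * δ ^ 2 / (64 * σ ^ 2))) := by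
    intro c hc
    have hY : ∀ t, HasLaw (fun ω => X t ω j + c * X t ω k)
        (gaussianReal 0 (S j j + c ^ 2 * S k k + 2 * c * S j k).toNNReal) P := by
      intro t
      have := hasLaw_inner_multivariateGaussian hS (hlaw t)
        (EuclideanSpace.single j 1 + c • EuclideanSpace.single k 1)
      rw [hvar c _ rfl] at this
      simpa only [hinner] using this
    have hYi : iIndepFun (fun t ω => X t ω j + c * X t ω k) P :=
      hindep.comp (fun _ x => x j + c * x k) (fun _ => by fun_prop)
    have hvb : ((S j j + c ^ 2 * S k k + 2 * c * S j k).toNNReal : ℝ) ≤ 4 * σ := by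
      rw [Real.coe_toNNReal _ (hv0 c)]
      -- The variances of `x_j ± x_k` are nonnegative and add up to `2(S j j + S k k) ≤ 4σ`.
      have h1 := hv0 (-c)
      have := hSσ j
      have := hSσ k
      rw [neg_sq] at h1
      rw [hc] at h1 ⊢
      linarith
    have := measureReal_abs_sum_sq_sub_var_ge_le hY hYi (b := 4 * σ) (s := 2 * δ) (by positivity)
      hvb (by positivity) (by linarith)
    rw [Real.coe_toNNReal _ (hv0 c)] at this
    refine this.trans (le_of_eq ?_)
    congr 3
    field_simp
    ring
  have hp := htail 1 (by norm_num)
  have hm := htail (-1) (by norm_num)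
  have hsub : {ω | δ < |(sampleCov (fun t => X t ω) - S) j k|} ⊆
      {ω | T * (2 * δ) ≤ |∑ t, ((X t ω j + 1 * X t ω k) ^ 2 -
        (S j j + 1 ^ 2 * S k k + 2 * 1 * S j k))|} ∪
      {ω | T * (2 * δ) ≤ |∑ t, ((X t ω j + (-1) * X t ω k) ^ 2 -
        (S j j + (-1) ^ 2 * S k k + 2 * (-1) * S j k))|} := by
    intro ω hω
    by_contra hcon
    simp only [Set.mem_union, Set.mem_ofPred_eq, not_or, not_le] at hcon hω
    have hT' : (0 : ℝ) < T := by exact_mod_cast hT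
    -- Polarization: `4 x_j x_k = (x_j + x_k)² - (x_j - x_k)²`.
    have hentry : 4 * (T * (sampleCov (fun t => X t ω) - S) j k) =
        ∑ t, ((X t ω j + 1 * X t ω k) ^ 2 - (S j j + 1 ^ 2 * S k k + 2 * 1 * S j k)) -
        ∑ t, ((X t ω j + (-1) * X t ω k) ^ 2 -
          (S j j + (-1) ^ 2 * S k k + 2 * (-1) * S j k)) := by
      have e1 : T * (sampleCov (fun t => X t ω) - S) j k = ∑ t, (X t ω j * X t ω k - S j k) := by
        rw [Matrix.sub_apply, sampleCov, Matrix.smul_apply, Matrix.sum_apply,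
          Finset.sum_sub_distrib]
        simp only [vecMulVec_apply, smul_eq_mul, Finset.sum_const, Finset.card_univ,
          Fintype.card_fin, nsmul_eq_mul]
        field_simp
      rw [e1, ← Finset.sum_sub_distrib, Finset.mul_sum]
      exact Finset.sum_congr rfl fun t _ => by ring
    have habs : |4 * (T * (sampleCov (fun t => X t ω) - S) j k)| < 4 * (T * δ) := by
      rw [hentry]
      refine (abs_sub _ _).trans_lt ?_
      linarith [hcon.1, hcon.2]
    rw [abs_mul, abs_mul, abs_of_pos hT', abs_of_pos (by norm_num : (0 : ℝ) < 4)] at habs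
    nlinarith [mul_lt_mul_of_pos_left hω hT']
  calc _ ≤ _ := measureReal_mono hsub
    _ ≤ _ := measureReal_union_le _ _
    _ ≤ _ := by linarith

end RMML

end

/-! ### Choice of the accuracy and the union bound. -/

open MeasureTheory ProbabilityTheory RMML in
theorem theorem3 {p : ℕ} [NeZero p] (G : SimpleGraph (Fin p)) (𝒩 : Neighborhoods G)
    -- the true concentration matrix, Markov with respect to `G`
    (Jstar : Matrix (Fin p) (Fin p) ℝ) (hJ : Jstar.PosDef)
    (hMarkov : ∀ i j, i ≠ j → ¬ G.Adj i j → Jstar i j = 0)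
    (κ : ℝ) (hκ : lambdaMax hJ.isHermitian ≤ κ)
    -- `T` i.i.d. samples of the centered Gaussian vector with concentration matrix `Jstar`
    {Ω : Type*} [MeasurableSpace Ω] (P : Measure Ω) [IsProbabilityMeasure P]
    {T : ℕ} (X : Fin T → Ω → EuclideanSpace ℝ (Fin p))
    (hlaw : ∀ t, HasLaw (X t) (multivariateGaussian 0 Jstar⁻¹) P)
    (hindep : iIndepFun X P)
    (C : ℝ) (hC : 1 ≤ C)
    (hT : C ^ 2 * sampleConst (maxVar Jstar⁻¹) κ (maxRelaxed G 𝒩) * Real.log p ≤ (T : ℝ)) :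
    ∃ A : Set Ω, MeasurableSet A ∧
      1 - 4 / (p : ℝ) ^ (2 * (C ^ 2 - 1)) < P.real A ∧
      ∀ ω ∈ A,
        (∃ J, IsRelaxEstimate G 𝒩 (sampleCov fun t => X t ω) J) ∧
        ∀ J, IsRelaxEstimate G 𝒩 (sampleCov fun t => X t ω) J →
          frobeniusNorm (J - Jstar) ≤
            720 * C * κ ^ 2 * maxVar Jstar⁻¹ *
              √((sumRelaxed G 𝒩 : ℝ) * Real.log p / T) := by
  -- for `p = 1` the probability bound is negative
  rcases Nat.lt_or_ge p 2 with hp | hp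
  · have hp1 : p = 1 := by have := NeZero.pos p; omega
    refine ⟨∅, MeasurableSet.empty, ?_, fun ω h => absurd h (Set.notMem_empty ω)⟩
    subst hp1
    norm_num
  have hp1 : (1 : ℝ) < p := by exact_mod_cast hp
  have hL : 0 < Real.log p := Real.log_pos hp1
  have hκ0 : 0 < κ := (lambdaMax_pos hJ).trans_le hκ
  have hJκ : ∀ x, dotProduct x (Jstar.mulVec x) ≤ κ * dotProduct x x := fun x => by
    refine (dotProduct_mulVec_le_lambdaMax hJ.isHermitian x).trans ?_
    have : 0 ≤ dotProduct x x := by simpa using dotProduct_self_star_nonneg x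
    gcongr
  set σ := maxVar Jstar⁻¹ with hσdef
  have hSσ : ∀ i, Jstar⁻¹ i i ≤ σ := fun i =>
    Finset.le_sup' (fun i => Jstar⁻¹ i i) (Finset.mem_univ i)
  -- Comes from `1 ≤ κ Σ*` as quadratic forms, tested on a basis vector. With `√R ≥ 1` it later
  -- yields `δ ≤ 2σ`.
  have hκσ : 1 ≤ κ * σ := by
    have h := hJ.dotProduct_self_le_inv hκ0 hJκ (Pi.single 0 1)
    simp only [Matrix.mulVec_single_one, single_one_dotProduct] at h
    simp only [Matrix.col_apply, Pi.single_eq_same] at h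
    exact h.trans (by gcongr; exact hSσ 0)
  have hσ : 0 < σ := pos_of_mul_pos_right (zero_lt_one.trans_le hκσ) hκ0.le
  set R := maxRelaxed G 𝒩 with hRdef
  have hRi : ∀ i, (relaxedEdges G (𝒩.set i)).card ≤ R := fun i =>
    Finset.le_sup (f := fun i => (relaxedEdges G (𝒩.set i)).card) (Finset.mem_univ i)
  have hR1 : (1 : ℝ) ≤ R := by
    exact_mod_cast (Finset.card_pos.2 ⟨_, mem_relaxedEdges_self 𝒩 0⟩).trans_le (hRi 0)
  have hsR : 1 ≤ √(R : ℝ) := Real.one_le_sqrt.2 hR1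
  set m := min (1 / (9 * κ * √(R : ℝ))) (40 * σ) with hm
  have hm0 : 0 < m := lt_min (by positivity) (by positivity)
  have hT' : C ^ 2 * (6400 * σ ^ 2 / m ^ 2) * Real.log p ≤ (T : ℝ) := hT
  have hTpos : (0 : ℝ) < T := lt_of_lt_of_le (by positivity) hT'
  -- With `80² = 6400` the sample size condition says exactly `δ ≤ m`, and `9 · 80 = 720` is the
  -- final constant.
  set δ := 80 * C * σ * √(Real.log p / T) with hδdef
  have hδ0 : 0 ≤ δ := by positivity
  have hδsq : δ ^ 2 = 6400 * C ^ 2 * σ ^ 2 * Real.log p / T := by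
    rw [hδdef, mul_pow, Real.sq_sqrt (by positivity)]; ring
  have hδm : δ ≤ m := by
    refine le_of_sq_le_sq ?_ hm0.le
    rw [hδsq, div_le_iff₀ hTpos]
    calc 6400 * C ^ 2 * σ ^ 2 * Real.log p
        = m ^ 2 * (C ^ 2 * (6400 * σ ^ 2 / m ^ 2) * Real.log p) := by field_simp
      _ ≤ _ := by gcongr
  have hδ1 : δ ≤ 1 / (9 * κ * √(R : ℝ)) := hδm.trans (min_le_left _ _)
  have hδ2 : κ * √(R : ℝ) * δ ≤ 1 / 9 := by
    calc κ * √(R : ℝ) * δ ≤ κ * √(R : ℝ) * (1 / (9 * κ * √(R : ℝ))) := by gcongr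
      _ = 1 / 9 := by field_simp
  have hδσ : δ ≤ 2 * σ := by
    have h1 : κ * δ ≤ κ * √(R : ℝ) * δ := by
      have : κ * 1 ≤ κ * √(R : ℝ) := by gcongr
      nlinarith
    have h2 : κ * δ ≤ κ * (2 * σ) := by linarith
    exact le_of_mul_le_mul_left h2 hκ0
  have hsmall : ∀ i, κ * √((relaxedEdges G (𝒩.set i)).card) * δ ≤ 1 / 9 := fun i => by
    refine le_trans ?_ hδ2
    gcongr
    exact hRi i
  set bad : Set Ω := ⋃ e : Fin p × Fin p,
    {ω | δ < |(sampleCov (fun t => X t ω) - Jstar⁻¹) e.1 e.2|} with hbad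
  have hTn : 0 < T := by exact_mod_cast hTpos
  -- Each of the `p²` entries fails with probability at most `4 p^(-100C²)`; the excess of 100 over
  -- 2 makes the inequality strict.
  have hpb : P.real bad < 4 / (p : ℝ) ^ (2 * (C ^ 2 - 1)) := by
    have hexp : (T : ℝ) * δ ^ 2 / (64 * σ ^ 2) = 100 * C ^ 2 * Real.log p := by
      rw [hδsq]; field_simp; norm_num
    have h1 : P.real bad ≤ ∑ _e : Fin p × Fin p, 4 * Real.exp (-(100 * C ^ 2 * Real.log p)) := by
      refine (measureReal_iUnion_fintype_le _).trans (Finset.sum_le_sum fun e _ => ?_)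
      rw [← hexp]
      exact measureReal_abs_sampleCov_sub_ge_le hTn hJ.inv.posSemidef hlaw hindep hσ hSσ hδ0 hδσ
        e.1 e.2
    have hp2 : (p : ℝ) * p = Real.exp (2 * Real.log p) := by
      rw [two_mul, Real.exp_add, Real.exp_log (by linarith)]
    refine h1.trans_lt ?_
    rw [Finset.sum_const, Finset.card_univ, Fintype.card_prod, Fintype.card_fin, nsmul_eq_mul,
      Nat.cast_mul, hp2, Real.rpow_def_of_pos (by linarith), div_eq_mul_inv, ← Real.exp_neg,
      mul_left_comm, ← Real.exp_add]
    gcongr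
    nlinarith [mul_pos hL (by positivity : 0 < C ^ 2)]
  -- The samples are only a.e. measurable, so `bad` is replaced by a measurable superset of equal
  -- measure.
  refine ⟨(toMeasurable P bad)ᶜ, (measurableSet_toMeasurable P bad).compl, ?_, fun ω hω => ?_⟩
  · have h : P.real (toMeasurable P bad) = P.real bad := by
      rw [measureReal_def, measure_toMeasurable, measureReal_def]
    rw [probReal_compl_eq_one_sub (measurableSet_toMeasurable P bad), h]
    linarith
  have hgood : ∀ i j, |(sampleCov (fun t => X t ω) - Jstar⁻¹) i j| ≤ δ := by
    intro i j
    by_contra h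
    exact hω (subset_toMeasurable P bad (Set.mem_iUnion.2 ⟨(i, j), not_le.1 h⟩))
  obtain ⟨hex, hall⟩ := relaxEstimate_deterministic 𝒩 hJ hMarkov hκ0 hJκ hδ0 hgood hsmall
  refine ⟨hex, fun J' hJ' => (hall J' hJ').trans (le_of_eq ?_)⟩
  rw [hδdef, mul_div_assoc, Real.sqrt_mul (Nat.cast_nonneg _)]
  ring
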